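/- Let $n\ge 0$ be an integer, let $\mathcal{H}_n=L^2(\mathbb{R}^n)$ be the Hilbert space of $n$ bosonic modes, $\mathcal{T}(\mathcal{H}_n)$ the space of trace-class operators with trace norm $\|T\|_1=\mathrm{Tr}\sqrt{T^\dagger T}$, and for $\xi\in\mathbb{R}^{2n}$ let $D(\xi)=e^{i\xi^{\mathsf T}\Omega r}$ be the Weyl displacement operator, where $r=(x_1,p_1,\ldots,x_n,p_n)^{\mathsf T}$, $[r_i,r_j]=i\Omega_{ij}$ and $\Omega=\begin{pmatrix}0&1\\-1&0\end{pmatrix}^{\oplus n}$. Write $\chi_T(\xi)=\mathrm{Tr}[T D(\xi)]$ for $T\in\mathcal{T}(\mathcal{H}_n)$. A linear bosonic channel $\Phi_{X,f}$ on $n$ modes is a completely positive trace-preserving linear map $\Phi:\mathcal{T}(\mathcal{H}_n)\to\mathcal{T}(\mathcal{H}_n)$ such that $\chi_{\Phi(T)}(\xi)=\chi_T(X\xi)\,f(\xi)$ for all $T\in\mathcal{T}(\mathcal{H}_n)$ and $\xi\in\mathbb{R}^{2n}$, for some real $2n\times 2n$ matrix $X$ and some function $f:\mathbb{R}^{2n}\to\mathbb{C}$.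 The strong operator topology on the linear maps $\Phi:\mathcal{T}(\mathcal{H}_n)\to\mathcal{T}(\mathcal{H}_n)$ is the topology of trace-norm convergence of $\Phi(\rho)$ for every density operator $\rho$ on $\mathcal{H}_n$. Theorem. (a) The set of all linear bosonic channels on $n$ modes is closed, in the space of all linear maps $\mathcal{T}(\mathcal{H}_n)\to\mathcal{T}(\mathcal{H}_n)$, with respect to the strong operator topology. (b) Let $(\Phi_{X_k,f_k})_{k}$ be a sequence of linear bosonic channels and let $\Phi:\mathcal{T}(\mathcal{H}_n)\to\mathcal{T}(\mathcal{H}_n)$ be a linear map such that $\|\Phi_{X_k,f_k}(\rho)-\Phi(\rho)\|_1\to 0$ for every density operator $\rho$. Then there are a real $2n\times 2n$ matrix $X$ and a function $f:\mathbb{R}^{2n}\to\mathbb{C}$ such that $X_k\to X$, $f_k(\xi)\to f(\xi)$ for every $\xi\in\mathbb{R}^{2n}$, and $\Phi$ is the linear bosonic channel $\Phi_{X,f}$. -/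

import Mathlib

open MeasureTheory Filter Topology
open scoped ENNReal ComplexOrder InnerProductSpace

namespace Bosonic

noncomputable section

/-! ## Trace, trace-class operators, trace norm

Throughout, `H` is a complex Hilbert space. -/

variable (H : Type*) [NormedAddCommGroup H] [InnerProductSpace ℂ H] [CompleteSpace H]

/-- The index set of a fixed orthonormal basis of the Hilbert space. -/
def basisIndex : Set H := (exists_hilbertBasis ℂ H).choose

/-- A fixed orthonormal basis of the Hilbert space. Traces do not depend on this choice. -/
def basis : HilbertBasis (basisIndex H) ℂ H := (exists_hilbertBasis ℂ H).choose_spec.choose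

variable {H}

/-- The trace `∑ᵢ ⟨eᵢ, A eᵢ⟩ ∈ [0, ∞]` of a positive operator `A`. -/
def posTrace (A : H →L[ℂ] H) : ℝ≥0∞ :=
  ∑' i, ENNReal.ofReal (⟪basis H i, A (basis H i)⟫_ℂ).re

/-- The trace `∑ᵢ ⟨eᵢ, T eᵢ⟩` of an operator (used for trace-class operators only, for which the
series converges absolutely). -/
def trace (T : H →L[ℂ] H) : ℂ :=
  ∑' i, ⟪basis H i, T (basis H i)⟫_ℂ

variable (H) in
/-- The space of trace-class operators: the linear span of the positive operators
with finite trace. -/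
def TraceClass : Submodule ℂ (H →L[ℂ] H) :=
  Submodule.span ℂ {A : H →L[ℂ] H | A.IsPositive ∧ posTrace A < ∞}

/-- The trace norm `‖T‖₁ = Tr √(T† T)`. -/
def traceNorm (T : H →L[ℂ] H) : ℝ≥0∞ :=
  posTrace (CFC.sqrt (star T * T))

/-- Density operators: positive trace-class operators with unit trace. -/
def IsDensity (ρ : TraceClass H) : Prop :=
  (ρ : H →L[ℂ] H).IsPositive ∧ trace (ρ : H →L[ℂ] H) = 1

/-! ## Quantum channels and the strong operator topology -/

variable (H) in
/-- Superoperators: linear maps on the space of trace-class operators. -/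
abbrev Superoperator : Type _ := TraceClass H →ₗ[ℂ] TraceClass H

/-- A block operator `[T i j]`, acting on the `m`-fold direct sum of the Hilbert space
(equivalently, on its tensor product with `ℂᵐ`), is positive semidefinite. -/
def BlockPositive {m : ℕ} (T : Fin m → Fin m → TraceClass H) : Prop :=
  ∀ v : Fin m → H, 0 ≤ ∑ i, ∑ j, ⟪v i, (T i j : H →L[ℂ] H) (v j)⟫_ℂ

/-- Complete positivity: all amplifications `Φ ⊗ id` with matrix algebras preserve positivity. -/
def IsCompletelyPositive (Φ : Superoperator H) : Prop :=
  ∀ (m : ℕ) (T : Fin m → Fin m → TraceClass H),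
    BlockPositive T → BlockPositive fun i j => Φ (T i j)

/-- Trace preservation. -/
def IsTracePreserving (Φ : Superoperator H) : Prop :=
  ∀ T : TraceClass H, trace (Φ T : H →L[ℂ] H) = trace (T : H →L[ℂ] H)

/-- Quantum channels: completely positive trace-preserving linear maps on the trace-class
operators. -/
def IsChannel (Φ : Superoperator H) : Prop :=
  IsCompletelyPositive Φ ∧ IsTracePreserving Φ

variable (H) in
/-- The strong operator topology on superoperators, generated by the open balls
`{Ψ | ‖Ψ(ρ) - Φ(ρ)‖₁ < ε}` with `Φ` a superoperator, `ρ` a density operator and `ε > 0`. -/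
@[reducible] def strongTopology : TopologicalSpace (Superoperator H) :=
  TopologicalSpace.generateFrom
    {U | ∃ (Φ : Superoperator H) (ρ : TraceClass H) (ε : ℝ), IsDensity ρ ∧ 0 < ε ∧
      U = {Ψ | traceNorm ((Ψ ρ : H →L[ℂ] H) - (Φ ρ : H →L[ℂ] H)) < ENNReal.ofReal ε}}

/-- Strong convergence of a sequence of superoperators: `‖Φₖ(ρ) - Φ(ρ)‖₁ → 0` for every density
operator `ρ`. -/
def StronglyTendsto (Φs : ℕ → Superoperator H) (Φ : Superoperator H) : Prop :=
  ∀ ρ : TraceClass H, IsDensity ρ →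
    Tendsto (fun k => traceNorm ((Φs k ρ : H →L[ℂ] H) - (Φ ρ : H →L[ℂ] H))) atTop (𝓝 0)

/-! ## Phase space, Hilbert space, displacement operators -/

/-- Phase space `ℝ²ⁿ` of `n` modes, coordinates ordered as `(x₁, p₁, …, xₙ, pₙ)`:
`ξ (j, 0)` and `ξ (j, 1)` are the two components of `ξ` belonging to mode `j`. -/
abbrev PhaseSpace (n : ℕ) : Type := Fin n × Fin 2 → ℝ

/-- Real `2n × 2n` matrices acting on phase space. -/
abbrev PhaseMatrix (n : ℕ) : Type := Matrix (Fin n × Fin 2) (Fin n × Fin 2) ℝ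

/-- The Hilbert space of `n` modes: square-integrable wave functions of the positions
`x₁, …, xₙ` (Schrödinger representation). -/
abbrev ModeSpace (n : ℕ) : Type := Lp ℂ 2 (volume : Measure (Fin n → ℝ))

/-- Bounded operators on the Hilbert space of `n` modes. -/
abbrev Operator (n : ℕ) : Type := ModeSpace n →L[ℂ] ModeSpace n

/-- The translation vector `(ξ (1,0), …, ξ (n,0))` of the displacement by `ξ`. -/
def shift {n : ℕ} (ξ : PhaseSpace n) : Fin n → ℝ := fun j => ξ (j, 0)

/-- The phase factor of the displacement by `ξ`. -/
def phase {n : ℕ} (ξ : PhaseSpace n) (x : Fin n → ℝ) : ℂ :=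
  Complex.exp (-Complex.I * ((∑ j, ξ (j, 1) * (x j + ξ (j, 0) / 2) : ℝ) : ℂ))

theorem norm_phase {n : ℕ} (ξ : PhaseSpace n) (x : Fin n → ℝ) : ‖phase ξ x‖ = 1 := by
  have h : -Complex.I * ((∑ j, ξ (j, 1) * (x j + ξ (j, 0) / 2) : ℝ) : ℂ)
      = ((-(∑ j, ξ (j, 1) * (x j + ξ (j, 0) / 2)) : ℝ) : ℂ) * Complex.I := by
    push_cast; ring
  rw [phase, h, Complex.norm_exp_ofReal_mul_I]

theorem continuous_phase {n : ℕ} (ξ : PhaseSpace n) : Continuous (phase ξ) := by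
  unfold phase
  fun_prop

theorem memLp_phase_mul {n : ℕ} (ξ : PhaseSpace n) (ψ : ModeSpace n) :
    MemLp (fun x => phase ξ x * ψ x) 2 (volume : Measure (Fin n → ℝ)) :=
  (Lp.memLp ψ).of_le ((continuous_phase ξ).aestronglyMeasurable.mul (Lp.aestronglyMeasurable ψ))
    (Eventually.of_forall fun x => by rw [norm_mul, norm_phase, one_mul])

/-- Multiplication by the phase factor, as a bounded operator. -/
def phaseMul {n : ℕ} (ξ : PhaseSpace n) : Operator n :=
  LinearMap.mkContinuous
    { toFun := fun ψ => (memLp_phase_mul ξ ψ).toLp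
      map_add' := fun ψ φ => by
        rw [← MemLp.toLp_add, MemLp.toLp_eq_toLp_iff]
        filter_upwards [Lp.coeFn_add ψ φ] with x hx
        simp only [hx, Pi.add_apply, mul_add]
      map_smul' := fun c ψ => by
        rw [RingHom.id_apply, ← MemLp.toLp_const_smul, MemLp.toLp_eq_toLp_iff]
        filter_upwards [Lp.coeFn_smul c ψ] with x hx
        simp only [hx, Pi.smul_apply, smul_eq_mul]
        ring }
    1
    (fun ψ => by
      rw [one_mul]
      refine Lp.norm_le_norm_of_ae_le ?_
      filter_upwards [MemLp.coeFn_toLp (memLp_phase_mul ξ ψ)] with x hx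
      simp only [LinearMap.coe_mk, AddHom.coe_mk, hx, norm_mul, norm_phase, one_mul, le_refl])

/-- The Weyl displacement operator `D(ξ) = exp (i ξᵀ Ω r)`, where
`r = (x₁, p₁, …, xₙ, pₙ)`, `[rᵢ, rⱼ] = i Ωᵢⱼ` and `Ω` is the direct sum of `n` blocks
`(0 1; -1 0)`. For `ξ = (a₁, b₁, …, aₙ, bₙ)` the exponent is `i ∑ⱼ (aⱼ pⱼ - bⱼ xⱼ)`, so that
`(D(ξ) ψ)(x) = exp (-i ∑ⱼ bⱼ (xⱼ + aⱼ / 2)) ψ(x + a)`. -/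
def displacement {n : ℕ} (ξ : PhaseSpace n) : Operator n :=
  (phaseMul ξ).comp
    (Lp.compMeasurePreservingₗᵢ ℂ (fun x : Fin n → ℝ => x + shift ξ)
      (measurePreserving_add_right volume (shift ξ))).toContinuousLinearMap

/-! ## Linear bosonic channels -/

/-- The characteristic function `χ_T(ξ) = Tr [T D(ξ)]` of a trace-class operator. -/
def charFun {n : ℕ} (T : TraceClass (ModeSpace n)) (ξ : PhaseSpace n) : ℂ :=
  trace ((T : Operator n) * displacement ξ)

/-- `Φ` is the linear bosonic channel `Φ_{X,f}`: a channel which acts on characteristic functions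
as `χ(ξ) ↦ χ(X ξ) f(ξ)`, that is, `Tr [Φ(T) D(ξ)] = f(ξ) Tr [T D(X ξ)]` for all `T` and `ξ`. -/
def IsLinearBosonicWith {n : ℕ} (Φ : Superoperator (ModeSpace n)) (X : PhaseMatrix n)
    (f : PhaseSpace n → ℂ) : Prop :=
  IsChannel Φ ∧ ∀ (T : TraceClass (ModeSpace n)) (ξ : PhaseSpace n),
    charFun (Φ T) ξ = charFun T (X.mulVec ξ) * f ξ

/-- The set of all linear bosonic channels on `n` modes. -/
def linearBosonicChannels (n : ℕ) : Set (Superoperator (ModeSpace n)) :=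
  {Φ | ∃ (X : PhaseMatrix n) (f : PhaseSpace n → ℂ), IsLinearBosonicWith Φ X f}

end

end Bosonic

/-! Trace-norm convergence on density operators forces convergence of `L (Φs k T)` for every
trace-class `T` and every functional `L` dominated by the trace norm. Matrix elements and `T ↦ Tr [T
D]` with a contraction `D` are such functionals. Hence complete positivity and trace preservation
survive in the limit, and `χ_T(X_k ξ) f_k(ξ) → χ_{Φ(T)}(ξ)` for all `T` and `ξ`.

To separate `X_k` from `f_k`, test with `T_c = |ψ_c⟩⟨ψ_0|`, where the `ψ_c` are coherent states. By
`charFun_coherentOp`, the quotient of the characteristic functions of `T_c` and `T_0` at `X_k ξ` is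
an exponential, affine in `X_k ξ` in the exponent, and `f_k(ξ)` cancels from it. Division is allowed
where `χ_{Φ(T_0)}(ξ) ≠ 0`, which holds near `ξ = 0` by continuity and trace preservation. Moduli of
the exponentials recover real parts without any ambiguity of the logarithm, so `X_k ξ` converges for
small `ξ`, and by linearity `X_k` converges. Then `f_k(ξ)` converges for every `ξ`, because
`χ_{T_0}` is continuous and vanishes nowhere.

All this works along an arbitrary nontrivial filter. This matters for (a), where sequences need not
describe closures. -/

namespace Bosonic

/-! ### Hilbert-Schmidt and trace-norm estimates -/

section OperatorTheory

theorem re_inner_mul_inner_swap {H : Type*} [NormedAddCommGroup H] [InnerProductSpace ℂ H]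
    (x y : H) : (⟪x, y⟫_ℂ * ⟪y, x⟫_ℂ).re = ‖⟪y, x⟫_ℂ‖ ^ 2 := by
  rw [← inner_conj_symm, ← Complex.normSq_eq_conj_mul_self, Complex.ofReal_re,
    Complex.normSq_eq_norm_sq]

variable {H : Type*} [NormedAddCommGroup H] [InnerProductSpace ℂ H] [CompleteSpace H]

/-- The square of the Hilbert-Schmidt norm. -/
noncomputable def hsNormSq (B : H →L[ℂ] H) : ℝ≥0∞ := ∑' i, ‖B (basis H i)‖ₑ ^ 2

theorem tsum_enorm_inner_basis_sq (x : H) : ∑' i, ‖⟪basis H i, x⟫_ℂ‖ₑ ^ 2 = ‖x‖ₑ ^ 2 := by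
  have h := (basis H).hasSum_inner_mul_inner x x
  have h2 : HasSum (fun i => ‖⟪basis H i, x⟫_ℂ‖ ^ 2) (‖x‖ ^ 2) := by
    have := Complex.hasSum_re h
    convert this using 1
    · funext i
      exact (re_inner_mul_inner_swap _ _).symm
    · rw [inner_self_eq_norm_sq_to_K]; norm_cast
  have h3 := ENNReal.ofReal_tsum_of_nonneg (fun i => by positivity) h2.summable
  rw [h2.tsum_eq] at h3
  rw [← ofReal_norm, ← ENNReal.ofReal_pow (norm_nonneg _), h3]
  refine tsum_congr fun i => ?_
  rw [← ofReal_norm, ← ENNReal.ofReal_pow (norm_nonneg _)]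

/-- Parseval turns both sides into double sums of squared matrix entries, which differ by the order
of summation. -/
theorem hsNormSq_adjoint (B : H →L[ℂ] H) : hsNormSq (star B) = hsNormSq B := by
  unfold hsNormSq
  simp_rw [← tsum_enorm_inner_basis_sq (star B _), ← tsum_enorm_inner_basis_sq (B _)]
  rw [ENNReal.tsum_comm]
  refine tsum_congr fun i => tsum_congr fun j => ?_
  rw [ContinuousLinearMap.star_eq_adjoint, ContinuousLinearMap.adjoint_inner_right,
    ← ofReal_norm, norm_inner_symm, ofReal_norm]

theorem hsNormSq_mul_le_right {U : H →L[ℂ] H} (hU : ‖U‖ ≤ 1) (B : H →L[ℂ] H) :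
    hsNormSq (U * B) ≤ hsNormSq B := by
  refine ENNReal.tsum_le_tsum fun i => ?_
  gcongr
  rw [← ofReal_norm, ← ofReal_norm]
  exact ENNReal.ofReal_le_ofReal ((U.le_of_opNorm_le hU _).trans (one_mul _).le)

theorem hsNormSq_mul_le_left {U : H →L[ℂ] H} (hU : ‖U‖ ≤ 1) (B : H →L[ℂ] H) :
    hsNormSq (B * U) ≤ hsNormSq B := by
  rw [← hsNormSq_adjoint, star_mul, ← hsNormSq_adjoint B]
  exact hsNormSq_mul_le_right (by rwa [norm_star]) _

theorem enorm_apply_sq_le (B : H →L[ℂ] H) (x : H) : ‖B x‖ₑ ^ 2 ≤ hsNormSq B * ‖x‖ₑ ^ 2 := by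
  rw [← tsum_enorm_inner_basis_sq (B x), ← hsNormSq_adjoint, hsNormSq, ← ENNReal.tsum_mul_right]
  refine ENNReal.tsum_le_tsum fun i => ?_
  rw [← mul_pow, ← ContinuousLinearMap.adjoint_inner_left, ← ContinuousLinearMap.star_eq_adjoint]
  gcongr
  simp_rw [← ofReal_norm]
  rw [← ENNReal.ofReal_mul (norm_nonneg _)]
  exact ENNReal.ofReal_le_ofReal (norm_inner_le_norm _ _)

theorem two_mul_tsum_enorm_inner_le (B C : H →L[ℂ] H) :
    2 * ∑' i, ‖⟪B (basis H i), C (basis H i)⟫_ℂ‖ₑ ≤ hsNormSq B + hsNormSq C := by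
  rw [hsNormSq, hsNormSq, ← ENNReal.tsum_add, ← ENNReal.tsum_mul_left]
  refine ENNReal.tsum_le_tsum fun i => ?_
  simp_rw [← ofReal_norm, ← ENNReal.ofReal_pow (norm_nonneg _)]
  rw [← ENNReal.ofReal_add (by positivity) (by positivity),
    show (2 : ℝ≥0∞) = ENNReal.ofReal 2 by simp, ← ENNReal.ofReal_mul (by norm_num)]
  refine ENNReal.ofReal_le_ofReal ?_
  nlinarith [norm_inner_le_norm (𝕜 := ℂ) (B (basis H i)) (C (basis H i)),
    sq_nonneg (‖B (basis H i)‖ - ‖C (basis H i)‖)]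

theorem star_sqrt (A : H →L[ℂ] H) : star (CFC.sqrt A) = CFC.sqrt A :=
  (CFC.sqrt_nonneg A).isSelfAdjoint.star_eq

theorem inner_sqrt_apply (A : H →L[ℂ] H) (x y : H) :
    ⟪CFC.sqrt A x, y⟫_ℂ = ⟪x, CFC.sqrt A y⟫_ℂ := by
  conv_lhs => rw [← star_sqrt A]
  rw [ContinuousLinearMap.star_eq_adjoint, ContinuousLinearMap.adjoint_inner_left]

theorem sqrt_apply_sqrt_apply {A : H →L[ℂ] H} (hA : A.IsPositive) (x : H) :
    CFC.sqrt A (CFC.sqrt A x) = A x := by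
  conv_rhs => rw [← CFC.sqrt_mul_sqrt_self A ((ContinuousLinearMap.nonneg_iff_isPositive A).2 hA)]
  rfl

theorem inner_sqrt_apply_sqrt_apply {A : H →L[ℂ] H} (hA : A.IsPositive) (x y : H) :
    ⟪CFC.sqrt A x, CFC.sqrt A y⟫_ℂ = ⟪x, A y⟫_ℂ := by
  rw [inner_sqrt_apply, sqrt_apply_sqrt_apply hA]

theorem hsNormSq_sqrt {A : H →L[ℂ] H} (hA : A.IsPositive) :
    hsNormSq (CFC.sqrt A) = posTrace A := by
  refine tsum_congr fun i => ?_
  rw [← inner_sqrt_apply_sqrt_apply hA, inner_self_eq_norm_sq_to_K, ← ofReal_norm,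
    ← ENNReal.ofReal_pow (norm_nonneg _)]
  norm_cast

theorem isPositive_sqrt (A : H →L[ℂ] H) : (CFC.sqrt A).IsPositive :=
  (ContinuousLinearMap.nonneg_iff_isPositive _).1 (CFC.sqrt_nonneg A)

theorem norm_sqrt_star_mul_self_apply (T : H →L[ℂ] H) (x : H) :
    ‖CFC.sqrt (star T * T) x‖ = ‖T x‖ := by
  have hp : (star T * T).IsPositive := ContinuousLinearMap.isPositive_adjoint_comp_self T
  have h := inner_sqrt_apply_sqrt_apply hp x x
  rw [ContinuousLinearMap.star_eq_adjoint, mul_apply_eq_comp,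
    ContinuousLinearMap.adjoint_inner_right, inner_self_eq_norm_sq_to_K,
    inner_self_eq_norm_sq_to_K] at h
  have h' : ‖CFC.sqrt (star T * T) x‖ ^ 2 = ‖T x‖ ^ 2 := by exact_mod_cast h
  exact (sq_eq_sq₀ (norm_nonneg _) (norm_nonneg _)).1 h'

/-- An approximate polar decomposition. -/
theorem exists_contraction_norm_sub_mul_sqrt_le (T : H →L[ℂ] H) {ε : ℝ} (hε : 0 < ε) :
    ∃ V : H →L[ℂ] H, ‖V‖ ≤ 1 ∧ ‖T - V * CFC.sqrt (star T * T)‖ ≤ ε := by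
  set P := CFC.sqrt (star T * T) with hP
  have hPpos : P.IsPositive := isPositive_sqrt _
  -- `P` may fail to be invertible, but `P + ε` is bounded below by `ε`; the contraction is `T Q⁻¹`.
  set Q : H →L[ℂ] H := P + (ε : ℂ) • 1 with hQ
  have hQx : ∀ x, Q x = P x + (ε : ℂ) • x := fun x => by simp [hQ]
  have hunit : IsUnit Q := by
    refine ContinuousLinearMap.isUnit_of_forall_le_norm_inner_map Q (c := ⟨ε, hε.le⟩) hε ?_
    intro x
    have h1 : (⟪Q x, x⟫_ℂ).re = (⟪P x, x⟫_ℂ).re + ε * ‖x‖ ^ 2 := by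
      rw [hQx, inner_add_left, inner_smul_left, inner_self_eq_norm_sq_to_K, Complex.add_re,
        Complex.conj_ofReal, Complex.re_ofReal_mul]
      norm_cast
    have h2 : 0 ≤ (⟪P x, x⟫_ℂ).re := hPpos.re_inner_nonneg_left x
    have h3 := Complex.re_le_norm ⟪Q x, x⟫_ℂ
    change ‖x‖ ^ 2 * ε ≤ _
    linarith
  obtain ⟨u, hu⟩ := hunit
  set R : H →L[ℂ] H := ↑u⁻¹ with hR
  have hQR : Q * R = 1 := by rw [← hu]; exact u.mul_inv
  have hRQ : R * Q = 1 := by rw [← hu]; exact u.inv_mul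
  -- `‖T R x‖ = ‖P R x‖ ≤ ‖P R x + ε R x‖ = ‖x‖`, as the cross term is nonnegative when `P ≥ 0`.
  have hV : ‖T * R‖ ≤ 1 := by
    refine ContinuousLinearMap.opNorm_le_bound _ zero_le_one fun x => ?_
    rw [one_mul, mul_apply_eq_comp, ← norm_sqrt_star_mul_self_apply, ← hP]
    have hx : x = P (R x) + (ε : ℂ) • R x := by
      rw [← hQx, ← mul_apply_eq_comp, hQR]; rfl
    conv_rhs => rw [hx]
    have h1 : (⟪P (R x), (ε : ℂ) • R x⟫_ℂ).re = ε * (⟪P (R x), R x⟫_ℂ).re := by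
      rw [inner_smul_right, Complex.re_ofReal_mul]
    have h2 : 0 ≤ (⟪P (R x), R x⟫_ℂ).re := hPpos.re_inner_nonneg_left _
    have h3 := norm_add_sq (𝕜 := ℂ) (P (R x)) ((ε : ℂ) • R x)
    have h4 : RCLike.re ⟪P (R x), (ε : ℂ) • R x⟫_ℂ = ε * (⟪P (R x), R x⟫_ℂ).re := h1
    rw [h4] at h3
    refine le_of_sq_le_sq ?_ (norm_nonneg _)
    rw [h3]
    nlinarith [mul_nonneg hε.le h2, sq_nonneg ‖(ε : ℂ) • R x‖]
  refine ⟨T * R, hV, ?_⟩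
  have h1 : T - T * R * P = (ε : ℂ) • (T * R) := by
    have : P = Q - (ε : ℂ) • 1 := by rw [hQ]; abel
    rw [this, mul_sub, mul_assoc, hRQ]
    simp
  rw [h1, norm_smul, Complex.norm_real, Real.norm_of_nonneg hε.le]
  exact mul_le_of_le_one_right hε.le hV

theorem hsNormSq_sqrt_sqrt_star_mul_self (T : H →L[ℂ] H) :
    hsNormSq (CFC.sqrt (CFC.sqrt (star T * T))) = traceNorm T :=
  hsNormSq_sqrt (isPositive_sqrt _)

/-- If `T = V P` with `P = √(T† T)` and `V` a contraction, splitting `P` into two square roots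
bounds the sum by Hilbert-Schmidt norms. The approximate polar decomposition reduces the general
case to this one, since each finite partial sum is norm continuous in the operator. -/
theorem tsum_enorm_inner_apply_le_traceNorm (T : H →L[ℂ] H) {D : H →L[ℂ] H} (hD : ‖D‖ ≤ 1) :
    ∑' i, ‖⟪basis H i, T (D (basis H i))⟫_ℂ‖ₑ ≤ traceNorm T := by
  set P := CFC.sqrt (star T * T) with hP
  have key : ∀ V : H →L[ℂ] H, ‖V‖ ≤ 1 →
      ∑' i, ‖⟪basis H i, (V * P) (D (basis H i))⟫_ℂ‖ₑ ≤ traceNorm T := by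
    intro V hV
    have h := two_mul_tsum_enorm_inner_le (CFC.sqrt P * star V) (CFC.sqrt P * D)
    have h2 : hsNormSq (CFC.sqrt P * star V) + hsNormSq (CFC.sqrt P * D) ≤ 2 * traceNorm T := by
      rw [two_mul, ← hsNormSq_sqrt_sqrt_star_mul_self]
      exact add_le_add (hsNormSq_mul_le_left (by rwa [norm_star]) _) (hsNormSq_mul_le_left hD _)
    have h3 := h.trans h2
    rw [ENNReal.mul_le_mul_iff_right (by norm_num) (by norm_num)] at h3
    convert h3 using 4 with i
    change _ = ⟪CFC.sqrt P (star V (basis H i)), CFC.sqrt P (D (basis H i))⟫_ℂ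
    rw [inner_sqrt_apply_sqrt_apply (isPositive_sqrt _),
      ContinuousLinearMap.star_eq_adjoint, ContinuousLinearMap.adjoint_inner_left]
    rfl
  choose V hV1 hV2 using fun n : ℕ =>
    exists_contraction_norm_sub_mul_sqrt_le T (Nat.one_div_pos_of_nat (α := ℝ) (n := n))
  have hlim : Tendsto (fun n => V n * P) atTop (𝓝 T) := by
    rw [tendsto_iff_norm_sub_tendsto_zero]
    refine squeeze_zero (fun _ => norm_nonneg _) (fun n => ?_)
      tendsto_one_div_add_atTop_nhds_zero_nat
    rw [norm_sub_rev]
    exact hV2 n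
  rw [ENNReal.tsum_eq_iSup_sum]
  refine iSup_le fun s => ?_
  have hs : Tendsto (fun n => ∑ i ∈ s, ‖⟪basis H i, (V n * P) (D (basis H i))⟫_ℂ‖ₑ) atTop
      (𝓝 (∑ i ∈ s, ‖⟪basis H i, T (D (basis H i))⟫_ℂ‖ₑ)) := by
    refine tendsto_finsetSum _ fun i _ => ?_
    have hc : Continuous fun A : H →L[ℂ] H => ‖⟪basis H i, A (D (basis H i))⟫_ℂ‖ₑ :=
      continuous_enorm.comp (continuous_const.inner
        (ContinuousLinearMap.apply ℂ H (D (basis H i))).continuous)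
    exact (hc.tendsto T).comp hlim
  exact le_of_tendsto' hs fun n => (ENNReal.sum_le_tsum s).trans (key (V n) (hV1 n))

theorem enorm_trace_mul_le (T : H →L[ℂ] H) {D : H →L[ℂ] H} (hD : ‖D‖ ≤ 1) :
    ‖trace (T * D)‖ₑ ≤ traceNorm T := by
  exact enorm_tsum_le_tsum_enorm.trans (tsum_enorm_inner_apply_le_traceNorm T hD)

/-- With `S` the fourth root of `T† T`, `‖T y‖ = ‖S S y‖ ≤ ‖S‖² ‖y‖`, and `‖S‖²` is at most the
squared Hilbert-Schmidt norm of `S`, which is the trace norm of `T`. -/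
theorem enorm_inner_apply_le_traceNorm (T : H →L[ℂ] H) (x y : H) :
    ‖⟪x, T y⟫_ℂ‖ₑ ≤ ‖x‖ₑ * ‖y‖ₑ * traceNorm T := by
  set S := CFC.sqrt (CFC.sqrt (star T * T)) with hS
  have hSn : ‖S‖ₑ ^ 2 ≤ traceNorm T := by
    rw [← hsNormSq_sqrt_sqrt_star_mul_self]
    by_cases htop : hsNormSq S = ∞
    · rw [htop]; exact le_top
    have hb : ‖S‖ ≤ √(hsNormSq S).toReal := by
      refine ContinuousLinearMap.opNorm_le_bound _ (Real.sqrt_nonneg _) fun x => ?_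
      have h := ENNReal.toReal_mono (ENNReal.mul_ne_top htop (by finiteness))
        (enorm_apply_sq_le S x)
      simp only [ENNReal.toReal_pow, toReal_enorm, ENNReal.toReal_mul] at h
      refine le_of_sq_le_sq ?_ (by positivity)
      rwa [mul_pow, Real.sq_sqrt ENNReal.toReal_nonneg]
    rw [← ofReal_norm, ← ENNReal.ofReal_pow (norm_nonneg _)]
    refine ENNReal.ofReal_le_of_le_toReal ?_
    calc ‖S‖ ^ 2 ≤ √(hsNormSq S).toReal ^ 2 := by gcongr
      _ = _ := Real.sq_sqrt ENNReal.toReal_nonneg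
  have hT : ‖⟪x, T y⟫_ℂ‖ ≤ ‖x‖ * ‖y‖ * ‖S‖ ^ 2 := by
    have h1 : ‖T y‖ ≤ ‖S‖ * (‖S‖ * ‖y‖) := by
      rw [← norm_sqrt_star_mul_self_apply, ← sqrt_apply_sqrt_apply (isPositive_sqrt _), ← hS]
      exact (S.le_opNorm _).trans (by gcongr; exact S.le_opNorm _)
    calc ‖⟪x, T y⟫_ℂ‖ ≤ ‖x‖ * ‖T y‖ := norm_inner_le_norm _ _
      _ ≤ ‖x‖ * (‖S‖ * (‖S‖ * ‖y‖)) := by gcongr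
      _ = _ := by ring
  calc ‖⟪x, T y⟫_ℂ‖ₑ ≤ ‖x‖ₑ * ‖y‖ₑ * ‖S‖ₑ ^ 2 := by
        simp_rw [← ofReal_norm]
        rw [← ENNReal.ofReal_pow (norm_nonneg _), ← ENNReal.ofReal_mul (norm_nonneg _),
          ← ENNReal.ofReal_mul (by positivity)]
        exact ENNReal.ofReal_le_ofReal hT
    _ ≤ _ := by gcongr

theorem summable_of_tsum_enorm_ne_top {ι : Type*} {f : ι → ℂ} (h : ∑' i, ‖f i‖ₑ ≠ ∞) :
    Summable f := by
  refine Summable.of_norm ?_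
  have := ENNReal.summable_toReal h
  simpa using this

theorem summable_inner_of_hsNormSq {B C : H →L[ℂ] H} (hB : hsNormSq B ≠ ∞) (hC : hsNormSq C ≠ ∞) :
    Summable fun i => ⟪B (basis H i), C (basis H i)⟫_ℂ := by
  refine summable_of_tsum_enorm_ne_top fun h => ?_
  have := two_mul_tsum_enorm_inner_le B C
  rw [h, ENNReal.mul_top (by norm_num), top_le_iff, ENNReal.add_eq_top] at this
  tauto

theorem hsNormSq_sqrt_ne_top {A : H →L[ℂ] H} (hA : A.IsPositive ∧ posTrace A < ∞) :
    hsNormSq (CFC.sqrt A) ≠ ∞ := by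
  rw [hsNormSq_sqrt hA.1]; exact hA.2.ne

theorem summable_trace_mul {T : H →L[ℂ] H} (hT : T ∈ TraceClass H) {D : H →L[ℂ] H}
    (hD : ‖D‖ ≤ 1) : Summable fun i => ⟪basis H i, (T * D) (basis H i)⟫_ℂ := by
  induction hT using Submodule.span_induction with
  | mem A hA =>
    have h := summable_inner_of_hsNormSq (hsNormSq_sqrt_ne_top hA)
      (C := CFC.sqrt A * D)
      (ne_top_of_le_ne_top (hsNormSq_sqrt_ne_top hA) (hsNormSq_mul_le_left hD _))
    refine h.congr fun i => ?_
    rw [mul_apply_eq_comp, mul_apply_eq_comp,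
      inner_sqrt_apply_sqrt_apply hA.1]
  | zero => simp
  | add S T _ _ hS hT => simpa [add_mul, inner_add_right] using hS.add hT
  | smul c T _ hT => simpa [inner_smul_right] using hT.mul_left c

/-- The functional `T ↦ Tr [T D]` on the trace-class operators, for a contraction `D`. -/
noncomputable def traceMul (D : H →L[ℂ] H) (hD : ‖D‖ ≤ 1) : TraceClass H →ₗ[ℂ] ℂ where
  toFun T := trace ((T : H →L[ℂ] H) * D)
  map_add' S T := by
    unfold trace
    rw [← (summable_trace_mul S.2 hD).tsum_add (summable_trace_mul T.2 hD)]
    simp [add_mul]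
  map_smul' c T := by
    unfold trace
    rw [RingHom.id_apply, smul_eq_mul, ← tsum_mul_left]
    simp

/-- The matrix element `T ↦ ⟨x, T y⟩` as a functional on the trace-class operators. -/
noncomputable def matrixElement (x y : H) : TraceClass H →ₗ[ℂ] ℂ where
  toFun T := ⟪x, (T : H →L[ℂ] H) y⟫_ℂ
  map_add' S T := by simp
  map_smul' c T := by simp

theorem trace_eq_of_isPositive {A : H →L[ℂ] H} (hA : A.IsPositive ∧ posTrace A < ∞) :
    trace A = ((posTrace A).toReal : ℂ) := by
  unfold posTrace trace
  rw [ENNReal.tsum_toReal_eq (fun i => ENNReal.ofReal_ne_top), Complex.ofReal_tsum]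
  refine tsum_congr fun i => ?_
  have h := hA.1.inner_nonneg_right (basis H i)
  rw [Complex.le_def] at h
  rw [ENNReal.toReal_ofReal h.1]
  exact Complex.ext (by simp) (by simpa using h.2.symm)

theorem eq_zero_of_posTrace_eq_zero {A : H →L[ℂ] H} (hA : A.IsPositive) (h : posTrace A = 0) :
    A = 0 := by
  ext x
  rw [← hsNormSq_sqrt hA] at h
  have h1 := enorm_apply_sq_le (CFC.sqrt A) x
  rw [h, zero_mul, nonpos_iff_eq_zero, pow_eq_zero_iff two_ne_zero, enorm_eq_zero] at h1
  rw [← sqrt_apply_sqrt_apply hA, h1]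
  simp

theorem trace_smul (c : ℂ) (A : H →L[ℂ] H) : trace (c • A) = c * trace A := by
  unfold trace
  rw [← tsum_mul_left]
  simp

/-- Trace-class operators are spanned by positive ones of finite trace, each of which is zero or a
positive multiple of a density operator. -/
theorem tendsto_apply_of_tendsto_traceNorm {ι : Type*} {l : Filter ι}
    {Φs : ι → Superoperator H} {Φ : Superoperator H}
    (h : ∀ ρ : TraceClass H, IsDensity ρ →
      Tendsto (fun k => traceNorm ((Φs k ρ : H →L[ℂ] H) - (Φ ρ : H →L[ℂ] H))) l (𝓝 0))
    (L : TraceClass H →ₗ[ℂ] ℂ) {C : ℝ≥0∞} (hC : C ≠ ∞)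
    (hL : ∀ T : TraceClass H, ‖L T‖ₑ ≤ C * traceNorm (T : H →L[ℂ] H)) (T : TraceClass H) :
    Tendsto (fun k => L (Φs k T)) l (𝓝 (L (Φ T))) := by
  obtain ⟨T, hT⟩ := T
  induction hT using Submodule.span_induction with
  | mem A hA =>
    set A' : TraceClass H := ⟨A, Submodule.subset_span hA⟩ with hA'
    by_cases h0 : posTrace A = 0
    · have : A' = 0 := Subtype.ext (eq_zero_of_posTrace_eq_zero hA.1 h0)
      simp only [this, map_zero]
      exact tendsto_const_nhds
    set t : ℝ := (posTrace A).toReal with ht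
    have htpos : 0 < t := ENNReal.toReal_pos h0 hA.2.ne
    set ρ : TraceClass H := ((t⁻¹ : ℝ) : ℂ) • A' with hρ
    have hAρ : A' = (t : ℂ) • ρ := by
      rw [hρ, smul_smul, ← Complex.ofReal_mul, mul_inv_cancel₀ htpos.ne']; simp
    have hdens : IsDensity ρ := by
      refine ⟨?_, ?_⟩
      · exact hA.1.smul_of_nonneg (by exact_mod_cast (inv_pos.2 htpos).le)
      · change trace (((t⁻¹ : ℝ) : ℂ) • A) = 1
        rw [trace_smul, trace_eq_of_isPositive hA, ← Complex.ofReal_mul,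
          inv_mul_cancel₀ htpos.ne', Complex.ofReal_one]
    have hlim : Tendsto (fun k => L (Φs k ρ)) l (𝓝 (L (Φ ρ))) := by
      rw [tendsto_iff_edist_tendsto_0]
      have h2 := ENNReal.Tendsto.const_mul (a := C) (h ρ hdens) (Or.inr hC)
      rw [mul_zero] at h2
      refine tendsto_of_tendsto_of_tendsto_of_le_of_le tendsto_const_nhds h2
        (fun _ => zero_le) fun k => ?_
      change edist _ _ ≤ _
      rw [edist_eq_enorm_sub, ← map_sub]
      exact hL _
    change Tendsto (fun k => L (Φs k A')) l (𝓝 (L (Φ A')))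
    rw [hAρ]
    simpa using hlim.const_mul (t : ℂ)
  | zero =>
    have : (⟨0, Submodule.zero_mem _⟩ : TraceClass H) = 0 := rfl
    simp only [this, map_zero]
    exact tendsto_const_nhds
  | add S T hS hT ihS ihT =>
    have : (⟨S + T, Submodule.add_mem _ hS hT⟩ : TraceClass H) = ⟨S, hS⟩ + ⟨T, hT⟩ := rfl
    simp only [this, map_add]
    exact ihS.add ihT
  | smul c T hT ih =>
    have : (⟨c • T, Submodule.smul_mem _ c hT⟩ : TraceClass H) = c • ⟨T, hT⟩ := rfl
    simp only [this, map_smul]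
    exact ih.const_smul c

/-! ### Cyclicity and continuity of traces, rank-one operators -/

theorem trace_mul_comm_of_hsNormSq {M N : H →L[ℂ] H} (hM : hsNormSq M ≠ ∞) (hN : hsNormSq N ≠ ∞) :
    trace (M * N) = trace (N * M) := by
  have expand : ∀ A B : H →L[ℂ] H, trace (A * B) =
      ∑' i, ∑' j, ⟪basis H i, A (basis H j)⟫_ℂ * ⟪basis H j, B (basis H i)⟫_ℂ := by
    intro A B
    refine tsum_congr fun i => ?_
    rw [mul_apply_eq_comp, ← ContinuousLinearMap.adjoint_inner_left,
      ← (basis H).tsum_inner_mul_inner]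
    simp_rw [ContinuousLinearMap.adjoint_inner_left]
  rw [expand, expand]
  have hs : Summable (Function.uncurry fun i j =>
      ⟪basis H i, M (basis H j)⟫_ℂ * ⟪basis H j, N (basis H i)⟫_ℂ) := by
    refine summable_of_tsum_enorm_ne_top
      (ne_top_of_le_ne_top (ENNReal.add_ne_top.2 ⟨hM, hN⟩) ?_)
    have h1 : hsNormSq M = ∑' p : basisIndex H × basisIndex H,
        ‖⟪basis H p.1, M (basis H p.2)⟫_ℂ‖ₑ ^ 2 := by
      rw [ENNReal.tsum_prod (f := fun i j => ‖⟪basis H i, M (basis H j)⟫_ℂ‖ₑ ^ 2),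
        ENNReal.tsum_comm]
      exact (tsum_congr fun i => tsum_enorm_inner_basis_sq _).symm
    have h2 : hsNormSq N = ∑' p : basisIndex H × basisIndex H,
        ‖⟪basis H p.2, N (basis H p.1)⟫_ℂ‖ₑ ^ 2 := by
      rw [ENNReal.tsum_prod (f := fun i j => ‖⟪basis H j, N (basis H i)⟫_ℂ‖ₑ ^ 2)]
      exact (tsum_congr fun i => tsum_enorm_inner_basis_sq _).symm
    rw [h1, h2, ← ENNReal.tsum_add]
    refine ENNReal.tsum_le_tsum fun p => ?_
    simp_rw [Function.uncurry, ← ofReal_norm, ← ENNReal.ofReal_pow (norm_nonneg _), norm_mul]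
    rw [← ENNReal.ofReal_add (by positivity) (by positivity)]
    refine ENNReal.ofReal_le_ofReal ?_
    nlinarith [sq_nonneg (‖⟪basis H p.1, M (basis H p.2)⟫_ℂ‖ - ‖⟪basis H p.2, N (basis H p.1)⟫_ℂ‖),
      sq_nonneg ‖⟪basis H p.1, M (basis H p.2)⟫_ℂ‖, sq_nonneg ‖⟪basis H p.2, N (basis H p.1)⟫_ℂ‖]
  refine hs.tsum_comm.symm.trans ?_
  exact tsum_congr fun i => tsum_congr fun j => mul_comm _ _

/-- For positive `A`, cyclicity rewrites the trace as `∑ᵢ ⟨√A eᵢ, D √A eᵢ⟩`, dominated by the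
summable `‖√A eᵢ‖²` uniformly in `D`; weak continuity of `D` then suffices. -/
theorem continuous_trace_mul {X : Type*} [TopologicalSpace X] {D : X → H →L[ℂ] H}
    (hD : ∀ x, ‖D x‖ ≤ 1) (hc : ∀ u v : H, Continuous fun x => ⟪u, D x v⟫_ℂ)
    {T : H →L[ℂ] H} (hT : T ∈ TraceClass H) : Continuous fun x => trace (T * D x) := by
  induction hT using Submodule.span_induction with
  | mem A hA =>
    have hfin := hsNormSq_sqrt_ne_top hA
    have h : ∀ x, trace (A * D x) =
        ∑' i, ⟪CFC.sqrt A (basis H i), D x (CFC.sqrt A (basis H i))⟫_ℂ := by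
      intro x
      have h1 : A * D x = CFC.sqrt A * (CFC.sqrt A * D x) := by
        rw [← mul_assoc, CFC.sqrt_mul_sqrt_self A
          ((ContinuousLinearMap.nonneg_iff_isPositive A).2 hA.1)]
      rw [h1, trace_mul_comm_of_hsNormSq hfin
        (ne_top_of_le_ne_top hfin (hsNormSq_mul_le_left (hD x) _))]
      refine tsum_congr fun i => ?_
      rw [mul_apply_eq_comp, mul_apply_eq_comp, inner_sqrt_apply]
    simp_rw [h]
    refine continuous_tsum (u := fun i => ‖CFC.sqrt A (basis H i)‖ ^ 2) (fun i => hc _ _) ?_ ?_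
    · have := ENNReal.summable_toReal hfin
      simpa using this
    · intro i x
      refine (norm_inner_le_norm _ _).trans ?_
      rw [sq]
      gcongr
      exact ((D x).le_of_opNorm_le (hD x) _).trans (one_mul _).le
  | zero => simpa [trace] using continuous_const
  | add S T hS hT ihS ihT =>
    have : ∀ x, trace ((S + T) * D x) = trace (S * D x) + trace (T * D x) := fun x =>
      (traceMul (D x) (hD x)).map_add ⟨S, hS⟩ ⟨T, hT⟩
    simp_rw [this]
    exact ihS.add ihT
  | smul c T _ ih =>
    simp_rw [smul_mul_assoc, trace_smul]
    exact ih.const_mul c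

theorem rankOne_self_mem_traceClass (x : H) :
    InnerProductSpace.rankOne ℂ x x ∈ TraceClass H := by
  refine Submodule.subset_span ⟨InnerProductSpace.isPositive_rankOne_self x, ?_⟩
  have : posTrace (InnerProductSpace.rankOne ℂ x x) = ‖x‖ₑ ^ 2 := by
    rw [← tsum_enorm_inner_basis_sq]
    refine tsum_congr fun i => ?_
    rw [InnerProductSpace.rankOne_apply, inner_smul_right, re_inner_mul_inner_swap,
      ENNReal.ofReal_pow (norm_nonneg _), ofReal_norm]
  rw [this]
  finiteness

theorem rankOne_mem_traceClass (x y : H) : InnerProductSpace.rankOne ℂ x y ∈ TraceClass H := by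
  -- Polarization: the first bracket is `|x⟩⟨y| + |y⟩⟨x|`, and the second, with its factor `i`, is
  -- `|x⟩⟨y| - |y⟩⟨x|`.
  have h1 : InnerProductSpace.rankOne ℂ x y = (1 / 2 : ℂ) •
      ((InnerProductSpace.rankOne ℂ (x + y) (x + y) - InnerProductSpace.rankOne ℂ x x
        - InnerProductSpace.rankOne ℂ y y)
      + Complex.I • (InnerProductSpace.rankOne ℂ (x + Complex.I • y) (x + Complex.I • y)
        - InnerProductSpace.rankOne ℂ x x - InnerProductSpace.rankOne ℂ y y)) := by
    ext z
    simp only [InnerProductSpace.rankOne_apply, smul_apply,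
      add_apply, sub_apply, inner_add_left,
      inner_smul_left, Complex.conj_I]
    match_scalars <;> ring_nf <;> simp [Complex.I_sq]
    ring
  rw [h1]
  have h := rankOne_self_mem_traceClass (H := H)
  exact Submodule.smul_mem _ _ (Submodule.add_mem _
    (Submodule.sub_mem _ (Submodule.sub_mem _ (h _) (h _)) (h _))
    (Submodule.smul_mem _ _ (Submodule.sub_mem _ (Submodule.sub_mem _ (h _) (h _)) (h _))))

theorem trace_rankOne_mul (x y : H) (D : H →L[ℂ] H) :
    trace (InnerProductSpace.rankOne ℂ x y * D) = ⟪y, D x⟫_ℂ := by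
  rw [← ContinuousLinearMap.adjoint_inner_left, ← (basis H).tsum_inner_mul_inner]
  refine tsum_congr fun i => ?_
  rw [mul_apply_eq_comp, InnerProductSpace.rankOne_apply, inner_smul_right,
    ContinuousLinearMap.adjoint_inner_left]

end OperatorTheory

/-! ### Displacement operators and continuity of characteristic functions -/

section Displacement

variable {n : ℕ}

theorem coeFn_phaseMul (ξ : PhaseSpace n) (ψ : ModeSpace n) :
    phaseMul ξ ψ =ᵐ[volume] fun x => phase ξ x * ψ x :=
  MemLp.coeFn_toLp (memLp_phase_mul ξ ψ)

theorem coeFn_displacement (ξ : PhaseSpace n) (ψ : ModeSpace n) :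
    displacement ξ ψ =ᵐ[volume] fun x => phase ξ x * ψ (x + shift ξ) := by
  have hmp := measurePreserving_add_right (volume : Measure (Fin n → ℝ)) (shift ξ)
  refine (coeFn_phaseMul ξ _).trans ?_
  filter_upwards [Lp.coeFn_compMeasurePreserving ψ hmp] with x hx
  exact congrArg (phase ξ x * ·) hx

theorem norm_phaseMul_le (ξ : PhaseSpace n) : ‖phaseMul ξ‖ ≤ 1 :=
  LinearMap.mkContinuous_norm_le _ zero_le_one _

theorem norm_displacement_le (ξ : PhaseSpace n) : ‖displacement ξ‖ ≤ 1 := by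
  refine (ContinuousLinearMap.opNorm_comp_le _ _).trans ?_
  exact mul_le_one₀ (norm_phaseMul_le ξ) (norm_nonneg _)
    (LinearIsometry.norm_toContinuousLinearMap_le _)

theorem displacement_zero : displacement (0 : PhaseSpace n) = 1 := by
  ext ψ
  refine (coeFn_displacement 0 ψ).trans (Eventually.of_forall fun x => ?_)
  have h : shift (0 : PhaseSpace n) = 0 := rfl
  simp [phase, h]

theorem continuous_phase_left (x : Fin n → ℝ) : Continuous fun ξ : PhaseSpace n => phase ξ x := by
  unfold phase
  fun_prop

theorem continuous_inner_phaseMul (u v : ModeSpace n) :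
    Continuous fun ξ : PhaseSpace n => ⟪u, phaseMul ξ v⟫_ℂ := by
  have h : ∀ ξ : PhaseSpace n, ⟪u, phaseMul ξ v⟫_ℂ = ∫ x, phase ξ x * ⟪u x, v x⟫_ℂ := by
    intro ξ
    rw [L2.inner_def]
    refine integral_congr_ae ?_
    filter_upwards [coeFn_phaseMul ξ v] with x hx
    rw [hx, ← smul_eq_mul, inner_smul_right]
  simp_rw [h]
  have hint := L2.integrable_inner (𝕜 := ℂ) u v
  refine continuous_of_dominated (bound := fun x => ‖⟪u x, v x⟫_ℂ‖) (fun ξ => ?_) (fun ξ => ?_)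
    hint.norm ?_
  · exact (continuous_phase ξ).aestronglyMeasurable.mul hint.aestronglyMeasurable
  · exact Eventually.of_forall fun x => by rw [norm_mul, norm_phase, one_mul]
  · exact Eventually.of_forall fun x => (continuous_phase_left x).mul continuous_const

theorem continuous_translation (v : ModeSpace n) : Continuous fun ξ : PhaseSpace n =>
    Lp.compMeasurePreservingₗᵢ ℂ (fun x : Fin n → ℝ => x + shift ξ)
      (measurePreserving_add_right volume (shift ξ)) v := by
  have hg : Continuous fun ξ : PhaseSpace n =>
      (⟨fun x : Fin n → ℝ => x + shift ξ, by fun_prop⟩ : C(Fin n → ℝ, Fin n → ℝ)) := by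
    refine ContinuousMap.continuous_of_continuous_uncurry _ ?_
    change Continuous fun p : PhaseSpace n × (Fin n → ℝ) => p.2 + shift p.1
    unfold shift
    fun_prop
  exact (continuous_const (y := v)).compMeasurePreservingLp hg
    (fun ξ => measurePreserving_add_right volume (shift ξ)) (by norm_num)

theorem continuous_inner_displacement (u v : ModeSpace n) :
    Continuous fun ξ : PhaseSpace n => ⟪u, displacement ξ v⟫_ℂ := by
  rw [continuous_iff_continuousAt]
  intro ξ₀
  set τ : PhaseSpace n → ModeSpace n := fun ξ =>
    Lp.compMeasurePreservingₗᵢ ℂ (fun x : Fin n → ℝ => x + shift ξ)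
      (measurePreserving_add_right volume (shift ξ)) v with hτ
  -- Freeze the translated vector at `ξ₀`: the phase is only weakly continuous, while the
  -- translation error is small in norm.
  have h : ∀ ξ, ⟪u, displacement ξ v⟫_ℂ
      = ⟪u, phaseMul ξ (τ ξ₀)⟫_ℂ + ⟪u, phaseMul ξ (τ ξ - τ ξ₀)⟫_ℂ := by
    intro ξ
    rw [← inner_add_right, ← map_add, add_sub_cancel]
    rfl
  have h2 : Tendsto (fun ξ => ⟪u, phaseMul ξ (τ ξ - τ ξ₀)⟫_ℂ) (𝓝 ξ₀) (𝓝 0) := by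
    refine squeeze_zero_norm (a := fun ξ => ‖u‖ * ‖τ ξ - τ ξ₀‖) (fun ξ => ?_) ?_
    · refine (norm_inner_le_norm _ _).trans ?_
      gcongr
      exact ((phaseMul ξ).le_of_opNorm_le (norm_phaseMul_le ξ) _).trans (one_mul _).le
    · have hc : Continuous fun ξ => ‖u‖ * ‖τ ξ - τ ξ₀‖ :=
        continuous_const.mul ((continuous_translation v).sub continuous_const).norm
      simpa using hc.tendsto ξ₀
  have h3 := ((continuous_inner_phaseMul u (τ ξ₀)).tendsto ξ₀).add h2
  simp_rw [← h] at h3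
  rw [ContinuousAt]
  convert h3 using 2
  simp [h ξ₀]

theorem continuous_charFun (T : TraceClass (ModeSpace n)) : Continuous (charFun T) :=
  continuous_trace_mul norm_displacement_le continuous_inner_displacement T.2

theorem charFun_zero (T : TraceClass (ModeSpace n)) :
    charFun T 0 = trace (T : Operator n) := by
  rw [charFun, displacement_zero, mul_one]

/-! ### Coherent states and their characteristic functions -/

/-- The wave function `x ↦ exp (-x² / 2 + c · x)` of a coherent state, up to normalization. -/
noncomputable def coherentFun (c : Fin n → ℂ) (x : Fin n → ℝ) : ℂ :=
  Complex.exp (∑ j, (-(x j : ℂ) ^ 2 / 2 + c j * x j))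

theorem continuous_coherentFun (c : Fin n → ℂ) : Continuous (coherentFun c) := by
  unfold coherentFun
  fun_prop

theorem memLp_coherentFun (c : Fin n → ℂ) : MemLp (coherentFun c) 2 volume := by
  rw [memLp_two_iff_integrable_sq_norm (continuous_coherentFun c).aestronglyMeasurable]
  have h := (GaussianFourier.integrable_cexp_neg_mul_sum_add (b := 1) (by simp)
    (fun j => 2 * c j)).norm
  refine h.congr (Eventually.of_forall fun x => ?_)
  simp only [coherentFun, Complex.norm_exp, ← Real.exp_nat_mul]
  congr 1
  simp only [neg_mul, one_mul, Complex.add_re, Complex.neg_re, Complex.re_sum, Finset.mul_sum,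
    ← Finset.sum_add_distrib]
  refine Finset.sum_congr rfl fun j _ => ?_
  simp [sq]
  ring

/-- The (unnormalized) coherent state with parameter `c`. -/
noncomputable def coherent (c : Fin n → ℂ) : ModeSpace n := (memLp_coherentFun c).toLp

theorem coeFn_coherent (c : Fin n → ℂ) : coherent c =ᵐ[volume] coherentFun c :=
  MemLp.coeFn_toLp _

/-- The complex amplitude `(a - i b) / 2` of the phase-space point with components `a`, `b`. -/
noncomputable def amplitude (ξ : PhaseSpace n) (j : Fin n) : ℂ :=
  ((ξ (j, 0) : ℂ) - Complex.I * ξ (j, 1)) / 2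

theorem inner_coherent_displacement (c : Fin n → ℂ) (ξ : PhaseSpace n) :
    ⟪coherent 0, displacement ξ (coherent c)⟫_ℂ = (Real.pi : ℂ) ^ (n / 2 : ℂ) *
      Complex.exp (∑ j, (c j ^ 2 / 4 + c j * amplitude ξ j
        - ((ξ (j, 0) : ℂ) ^ 2 + (ξ (j, 1) : ℂ) ^ 2) / 4)) := by
  have hmp := measurePreserving_add_right (volume : Measure (Fin n → ℝ)) (shift ξ)
  -- Collecting powers of `x` leaves a Gaussian with linear coefficient `d = c - a - i b` in each
  -- mode; the `d² / 4` from its integral cancels the term `-i a b / 2`.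
  have h : ⟪coherent 0, displacement ξ (coherent c)⟫_ℂ = ∫ x : Fin n → ℝ,
      Complex.exp (∑ j, (-(ξ (j, 0) : ℂ) ^ 2 / 2 + c j * ξ (j, 0)
        - Complex.I * ξ (j, 0) * ξ (j, 1) / 2)) *
      Complex.exp (-1 * ∑ j, (x j : ℂ) ^ 2
        + ∑ j, (c j - ξ (j, 0) - Complex.I * ξ (j, 1)) * x j) := by
    rw [L2.inner_def]
    refine integral_congr_ae ?_
    filter_upwards [coeFn_displacement ξ (coherent c), coeFn_coherent (0 : Fin n → ℂ),
      hmp.quasiMeasurePreserving.ae_eq_comp (coeFn_coherent c)] with x h1 h2 h3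
    have h3' : coherent c (x + shift ξ) = coherentFun c (x + shift ξ) := h3
    rw [h1, h2, h3', RCLike.inner_apply, coherentFun, coherentFun, phase, ← Complex.exp_conj,
      ← Complex.exp_add, ← Complex.exp_add, ← Complex.exp_add]
    congr 1
    push_cast
    simp only [map_sum, Finset.mul_sum, ← Finset.sum_add_distrib]
    refine Finset.sum_congr rfl fun j _ => ?_
    have h2 : (starRingEnd ℂ) 2 = 2 := map_ofNat _ 2
    simp [shift, h2]
    ring
  rw [h, integral_const_mul, GaussianFourier.integral_cexp_neg_mul_sum_add (by simp)]
  rw [Fintype.card_fin, div_one, mul_left_comm, ← Complex.exp_add, Finset.sum_div,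
    ← Finset.sum_add_distrib]
  congr 2
  refine Finset.sum_congr rfl fun j _ => ?_
  simp only [amplitude]
  ring_nf
  simp only [Complex.I_sq]
  ring

/-- The trace-class operator `|ψ_c⟩⟨ψ_0|` built from two coherent states. -/
noncomputable def coherentOp (c : Fin n → ℂ) : TraceClass (ModeSpace n) :=
  ⟨InnerProductSpace.rankOne ℂ (coherent c) (coherent 0), rankOne_mem_traceClass _ _⟩

theorem charFun_coherentOp (c : Fin n → ℂ) (ξ : PhaseSpace n) :
    charFun (coherentOp c) ξ = charFun (coherentOp 0) ξ *
      Complex.exp (∑ j, (c j ^ 2 / 4 + c j * amplitude ξ j)) := by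
  have h : ∀ c : Fin n → ℂ, charFun (coherentOp c) ξ
      = ⟪coherent 0, displacement ξ (coherent c)⟫_ℂ := fun c => trace_rankOne_mul _ _ _
  rw [h, h, inner_coherent_displacement, inner_coherent_displacement, mul_assoc, ← Complex.exp_add,
    ← Finset.sum_add_distrib]
  congr 2
  refine Finset.sum_congr rfl fun j _ => ?_
  simp only [Pi.zero_apply]
  ring

theorem charFun_coherentOp_zero_ne_zero (ξ : PhaseSpace n) : charFun (coherentOp 0) ξ ≠ 0 := by
  have h : charFun (coherentOp 0) ξ
      = ⟪coherent 0, displacement ξ (coherent 0)⟫_ℂ := trace_rankOne_mul _ _ _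
  rw [h, inner_coherent_displacement]
  refine mul_ne_zero ?_ (Complex.exp_ne_zero _)
  rw [Ne, Complex.cpow_eq_zero_iff]
  simp [Real.pi_ne_zero]

end Displacement

/-! ### Limits of channels and of their parameters -/

section Limits

variable {ι : Type*} {l : Filter ι}

/-- The two limits multiply to `1`, so `w ≠ 0` and `log ‖·‖` is continuous there. Imaginary parts
would be determined only modulo `2π`. -/
theorem exists_tendsto_re_of_tendsto_exp [l.NeBot] {z : ι → ℂ} {w w' : ℂ}
    (h : Tendsto (fun k => Complex.exp (z k)) l (𝓝 w))
    (h' : Tendsto (fun k => Complex.exp (-z k)) l (𝓝 w')) :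
    ∃ r : ℝ, Tendsto (fun k => (z k).re) l (𝓝 r) := by
  have h1 : Tendsto (fun _ : ι => (1 : ℂ)) l (𝓝 (w * w')) := by
    refine (h.mul h').congr fun k => ?_
    rw [← Complex.exp_add, add_neg_cancel, Complex.exp_zero]
  have hw : w ≠ 0 := by
    rintro rfl
    rw [zero_mul] at h1
    exact one_ne_zero (tendsto_nhds_unique tendsto_const_nhds h1)
  refine ⟨Real.log ‖w‖, ?_⟩
  refine ((Real.continuousAt_log (norm_ne_zero_iff.2 hw)).tendsto.comp h.norm).congr fun k => ?_
  simp [Complex.norm_exp]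

section Superoperators

variable {H : Type*} [NormedAddCommGroup H] [InnerProductSpace ℂ H] [CompleteSpace H]
  {Φs : ι → Superoperator H} {Φ : Superoperator H}

theorem tendsto_trace_mul_of_tendsto_traceNorm
    (h : ∀ ρ : TraceClass H, IsDensity ρ →
      Tendsto (fun k => traceNorm ((Φs k ρ : H →L[ℂ] H) - (Φ ρ : H →L[ℂ] H))) l (𝓝 0))
    {D : H →L[ℂ] H} (hD : ‖D‖ ≤ 1) (T : TraceClass H) :
    Tendsto (fun k => trace ((Φs k T : H →L[ℂ] H) * D)) l (𝓝 (trace ((Φ T : H →L[ℂ] H) * D))) :=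
  tendsto_apply_of_tendsto_traceNorm h (traceMul D hD) ENNReal.one_ne_top
    (fun _ => (enorm_trace_mul_le _ hD).trans (one_mul _).ge) T

theorem isChannel_of_tendsto_traceNorm [l.NeBot] (hΦs : ∀ k, IsChannel (Φs k))
    (h : ∀ ρ : TraceClass H, IsDensity ρ →
      Tendsto (fun k => traceNorm ((Φs k ρ : H →L[ℂ] H) - (Φ ρ : H →L[ℂ] H))) l (𝓝 0)) :
    IsChannel Φ := by
  constructor
  · intro m T hT v
    have hlim : Tendsto (fun k => ∑ i, ∑ j, ⟪v i, (Φs k (T i j) : H →L[ℂ] H) (v j)⟫_ℂ) l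
        (𝓝 (∑ i, ∑ j, ⟪v i, (Φ (T i j) : H →L[ℂ] H) (v j)⟫_ℂ)) :=
      tendsto_finsetSum _ fun i _ => tendsto_finsetSum _ fun j _ =>
        tendsto_apply_of_tendsto_traceNorm h (matrixElement (v i) (v j))
          (C := ‖v i‖ₑ * ‖v j‖ₑ) (by finiteness)
          (fun _ => enorm_inner_apply_le_traceNorm _ _ _) (T i j)
    exact ge_of_tendsto' hlim fun k => (hΦs k).1 m T hT v
  · intro T
    have hD : ‖(1 : H →L[ℂ] H)‖ ≤ 1 := ContinuousLinearMap.norm_id_le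
    have hlim := tendsto_trace_mul_of_tendsto_traceNorm h hD T
    simp_rw [mul_one, (hΦs _).2 T] at hlim
    exact tendsto_nhds_unique hlim tendsto_const_nhds

end Superoperators

variable {n : ℕ}

/-- Characteristic functions of coherent operators `|ψ_c⟩⟨ψ_0|` detect convergence in phase
space. -/
theorem exists_tendsto_of_tendsto_charFun [l.NeBot] {η : ι → PhaseSpace n}
    {F : ι → ℂ} {g : (Fin n → ℂ) → ℂ} (hg : g 0 ≠ 0)
    (h : ∀ c, Tendsto (fun k => charFun (coherentOp c) (η k) * F k) l (𝓝 (g c))) :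
    ∃ η' : PhaseSpace n, Tendsto η l (𝓝 η') := by
  have hne : ∀ᶠ k in l, charFun (coherentOp 0) (η k) * F k ≠ 0 := (h 0).eventually_ne hg
  have hexp : ∀ (j : Fin n) (t : ℂ),
      ∃ w, Tendsto (fun k => Complex.exp (t * amplitude (η k) j)) l (𝓝 w) := by
    intro j t
    -- The quotient removes `F k`; the constant removes the factor `exp (t² / 4)`.
    have h1 := ((h (Pi.single j t)).div (h 0) hg).const_mul (Complex.exp (-(t ^ 2 / 4)))
    refine ⟨_, h1.congr' ?_⟩
    filter_upwards [hne] with k hk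
    have hsum : ∑ i, ((Pi.single j t : Fin n → ℂ) i ^ 2 / 4
        + (Pi.single j t : Fin n → ℂ) i * amplitude (η k) i)
        = t ^ 2 / 4 + t * amplitude (η k) j := by
      rw [Finset.sum_eq_single j]
      · simp
      · intro i _ hij
        simp [Pi.single_eq_of_ne hij]
      · simp
    rw [Pi.div_apply, charFun_coherentOp (Pi.single j t), hsum, mul_right_comm,
      mul_div_cancel_left₀ _ hk, ← Complex.exp_add, neg_add_cancel_left]
  have hre : ∀ (j : Fin n) (t : ℂ),
      ∃ r : ℝ, Tendsto (fun k => (t * amplitude (η k) j).re) l (𝓝 r) := by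
    intro j t
    obtain ⟨w, hw⟩ := hexp j t
    obtain ⟨w', hw'⟩ := hexp j (-t)
    simp_rw [neg_mul] at hw'
    exact exists_tendsto_re_of_tendsto_exp hw hw'
  have hcoord : ∀ p : Fin n × Fin 2, ∃ r : ℝ, Tendsto (fun k => η k p) l (𝓝 r) := by
    rintro ⟨j, i⟩
    fin_cases i
    -- `t = 1` yields half the first component of the mode, `t = i` half the second.
    · obtain ⟨r, hr⟩ := hre j 1
      refine ⟨_, (hr.const_mul 2).congr fun k => ?_⟩
      simp [amplitude]
      ring
    · obtain ⟨r, hr⟩ := hre j Complex.I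
      refine ⟨_, (hr.const_mul 2).congr fun k => ?_⟩
      simp [amplitude]
      ring
  choose η' hη' using hcoord
  exact ⟨η', tendsto_pi_nhds.2 hη'⟩

theorem exists_tendsto_matrix {m : Type*} [Fintype m] [DecidableEq m] {X : ι → Matrix m m ℝ}
    (h : ∀ᶠ ξ : m → ℝ in 𝓝 0, ∃ η, Tendsto (fun k => (X k).mulVec ξ) l (𝓝 η)) :
    ∃ X', Tendsto X l (𝓝 X') := by
  have hentry : ∀ i j, ∃ r : ℝ, Tendsto (fun k => X k i j) l (𝓝 r) := by
    intro i j
    -- Convergence is known only near `0`, so the basis vector is scaled by a small `s > 0` and the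
    -- entry divided by `s`.
    have hc : Tendsto (fun s : ℝ => s • (Pi.single j 1 : m → ℝ)) (𝓝[>] 0) (𝓝 0) := by
      have : Continuous fun s : ℝ => s • (Pi.single j 1 : m → ℝ) := by fun_prop
      simpa using (this.tendsto 0).mono_left nhdsWithin_le_nhds
    obtain ⟨s, ⟨η, hη⟩, hs⟩ := ((hc.eventually h).and self_mem_nhdsWithin).exists
    have hs' : s ≠ 0 := (Set.mem_Ioi.1 hs).ne'
    refine ⟨_, ((tendsto_pi_nhds.1 hη i).const_mul s⁻¹).congr fun k => ?_⟩
    simp [Matrix.mulVec_smul, hs']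
  choose X' hX' using hentry
  exact ⟨X', tendsto_pi_nhds.2 fun i => tendsto_pi_nhds.2 fun j => hX' i j⟩

/-- Linear bosonic channels are stable under strong limits along arbitrary filters, and their
parameters converge. -/
theorem exists_isLinearBosonicWith_of_tendsto [l.NeBot]
    {Φs : ι → Superoperator (ModeSpace n)} {X : ι → PhaseMatrix n} {f : ι → PhaseSpace n → ℂ}
    {Φ : Superoperator (ModeSpace n)}
    (hΦs : ∀ k, IsLinearBosonicWith (Φs k) (X k) (f k))
    (h : ∀ ρ : TraceClass (ModeSpace n), IsDensity ρ →
      Tendsto (fun k => traceNorm ((Φs k ρ : Operator n) - (Φ ρ : Operator n))) l (𝓝 0)) :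
    ∃ (X' : PhaseMatrix n) (f' : PhaseSpace n → ℂ), Tendsto X l (𝓝 X') ∧
      (∀ ξ, Tendsto (fun k => f k ξ) l (𝓝 (f' ξ))) ∧ IsLinearBosonicWith Φ X' f' := by
  have hchan : IsChannel Φ := isChannel_of_tendsto_traceNorm (fun k => (hΦs k).1) h
  have hχ : ∀ T ξ, Tendsto (fun k => charFun T ((X k).mulVec ξ) * f k ξ) l
      (𝓝 (charFun (Φ T) ξ)) := by
    intro T ξ
    refine (tendsto_trace_mul_of_tendsto_traceNorm h (norm_displacement_le ξ) T).congr fun k => ?_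
    exact (hΦs k).2 T ξ
  have hnear : ∀ᶠ ξ in 𝓝 0, charFun (Φ (coherentOp 0)) ξ ≠ 0 := by
    refine (continuous_charFun _).continuousAt.eventually_ne ?_
    rw [charFun_zero, hchan.2, ← charFun_zero]
    exact charFun_coherentOp_zero_ne_zero 0
  obtain ⟨X', hX'⟩ := exists_tendsto_matrix (hnear.mono fun ξ hξ =>
    exists_tendsto_of_tendsto_charFun (F := fun k => f k ξ)
      (g := fun c => charFun (Φ (coherentOp c)) ξ) hξ fun c => hχ (coherentOp c) ξ)
  have hχX : ∀ T ξ, Tendsto (fun k => charFun T ((X k).mulVec ξ)) l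
      (𝓝 (charFun T (X'.mulVec ξ))) := by
    intro T ξ
    have hc : Continuous fun Y : PhaseMatrix n => charFun T (Y.mulVec ξ) :=
      (continuous_charFun T).comp (continuous_id.matrix_mulVec continuous_const)
    exact (hc.tendsto X').comp hX'
  have hf : ∀ ξ, Tendsto (fun k => f k ξ) l
      (𝓝 (charFun (Φ (coherentOp 0)) ξ / charFun (coherentOp 0) (X'.mulVec ξ))) := by
    intro ξ
    refine ((hχ (coherentOp 0) ξ).div (hχX (coherentOp 0) ξ)
      (charFun_coherentOp_zero_ne_zero _)).congr fun k => ?_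
    exact mul_div_cancel_left₀ _ (charFun_coherentOp_zero_ne_zero _)
  exact ⟨X', _, hX', hf, hchan, fun T ξ =>
    tendsto_nhds_unique (hχ T ξ) ((hχX T ξ).mul (hf ξ))⟩

end Limits

/-! ### Closedness in the strong operator topology -/

theorem traceNorm_zero {H : Type*} [NormedAddCommGroup H] [InnerProductSpace ℂ H]
    [CompleteSpace H] : traceNorm (0 : H →L[ℂ] H) = 0 := by
  simp [traceNorm, posTrace]

theorem tendsto_traceNorm_nhds {H : Type*} [NormedAddCommGroup H] [InnerProductSpace ℂ H]
    [CompleteSpace H] (Φ : Superoperator H) {ρ : TraceClass H} (hρ : IsDensity ρ) :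
    Tendsto (fun Ψ : Superoperator H => traceNorm ((Ψ ρ : H →L[ℂ] H) - (Φ ρ : H →L[ℂ] H)))
      (@nhds _ (strongTopology H) Φ) (𝓝 0) := by
  let := strongTopology H
  rw [ENNReal.tendsto_nhds_zero]
  intro ε hε
  obtain ⟨δ, hδ0, hδε⟩ := ENNReal.lt_iff_exists_real_btwn.1 hε
  have hδ : 0 < δ := by simpa using hδε.1
  have hopen : IsOpen {Ψ : Superoperator H |
      traceNorm ((Ψ ρ : H →L[ℂ] H) - (Φ ρ : H →L[ℂ] H)) < ENNReal.ofReal δ} :=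
    TopologicalSpace.isOpen_generateFrom_of_mem ⟨Φ, ρ, δ, hρ, hδ, rfl⟩
  have hmem : Φ ∈ {Ψ : Superoperator H |
      traceNorm ((Ψ ρ : H →L[ℂ] H) - (Φ ρ : H →L[ℂ] H)) < ENNReal.ofReal δ} := by
    simpa [traceNorm_zero] using hδ
  filter_upwards [hopen.mem_nhds hmem] with Ψ hΨ
  exact (le_of_lt hΨ).trans hδε.2.le

theorem isClosed_linearBosonicChannels (n : ℕ) :
    IsClosed[strongTopology (ModeSpace n)] (linearBosonicChannels n) := by
  let := strongTopology (ModeSpace n)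
  refine isClosed_of_closure_subset fun Φ hΦ => ?_
  -- The index type of the limit is the set of channels itself, filtered by the neighbourhoods of
  -- `Φ`.
  have hne : (comap ((↑) : linearBosonicChannels n → Superoperator (ModeSpace n)) (𝓝 Φ)).NeBot :=
    mem_closure_iff_comap_neBot.1 hΦ
  choose X f hXf using fun Ψ : linearBosonicChannels n => Ψ.2
  obtain ⟨X', f', -, -, hlim⟩ := exists_isLinearBosonicWith_of_tendsto hXf
    fun ρ hρ => (tendsto_traceNorm_nhds Φ hρ).comp tendsto_comap
  exact ⟨X', f', hlim⟩

end Bosonic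

theorem theorem1 (n : ℕ) :
    IsClosed[Bosonic.strongTopology (Bosonic.ModeSpace n)] (Bosonic.linearBosonicChannels n) ∧
    ∀ (Φs : ℕ → Bosonic.Superoperator (Bosonic.ModeSpace n))
      (X : ℕ → Bosonic.PhaseMatrix n)
      (f : ℕ → Bosonic.PhaseSpace n → ℂ) (Φ : Bosonic.Superoperator (Bosonic.ModeSpace n)),
      (∀ k, Bosonic.IsLinearBosonicWith (Φs k) (X k) (f k)) →
      Bosonic.StronglyTendsto Φs Φ →
      ∃ (X' : Bosonic.PhaseMatrix n) (f' : Bosonic.PhaseSpace n → ℂ),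
        Tendsto X atTop (𝓝 X') ∧
        (∀ ξ : Bosonic.PhaseSpace n, Tendsto (fun k => f k ξ) atTop (𝓝 (f' ξ))) ∧
        Bosonic.IsLinearBosonicWith Φ X' f' :=
  ⟨Bosonic.isClosed_linearBosonicChannels n, fun _ _ _ _ hΦs h =>
    Bosonic.exists_isLinearBosonicWith_of_tendsto hΦs h⟩
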